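/- **Setting.** Let $X_N^{(r)}$ be one of the affine types $A^{(1)}_n\ (n\ge 1)$, $B^{(1)}_n\ (n\ge 3)$, $C^{(1)}_n\ (n\ge 2)$, $D^{(1)}_n\ (n\ge 4)$, $E^{(1)}_6,E^{(1)}_7,E^{(1)}_8$, $F^{(1)}_4$, $G^{(1)}_2$, $A^{(2)}_{2n}\ (n\ge 1)$, $A^{(2)}_{2n-1}\ (n\ge 2)$, $D^{(2)}_{n+1}\ (n\ge 2)$, $E^{(2)}_6$, $D^{(3)}_4$. Let $\mathfrak g=X_N$ be the simple Lie algebra with Dynkin nodes $I=\{1,\dots,N\}$ and Cartan matrix $A'=(A'_{ij})$, let $\sigma$ be the diagram automorphism of order $r$, and let $\mathfrak g_0$ be the $\sigma$-invariant subalgebra, with Cartan matrix $A=(A_{ab})$ indexed by the set $I_\sigma$ of $\sigma$-orbits in $I$; thus $\mathfrak g_0=X_n$ if $r=1$, and $\mathfrak g_0=B_n,C_n,B_n,F_4,G_2$ for $A^{(2)}_{2n},A^{(2)}_{2n-1},D^{(2)}_{n+1},E^{(2)}_6,D^{(3)}_4$, respectively. Label $I$ so that $1,\dots,n$ represent the orbits,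 adjacent orbits being represented by adjacent nodes, identify $I_\sigma$ with $\{1,\dots,n\}\subseteq I$, and read $A'_{ab}$ and $d'_a$ for $a,b\in I_\sigma$ accordingly. (Cartan matrices are normalized so that $l_iA_{ij}$ is symmetric when $l_i$ is the squared length of the $i$-th simple root.) Let $d'_i$ ($i\in I$) be the coprime positive integers such that $(d'_iA'_{ij})$ is symmetric, and let $\epsilon_a=2$ if $A'_{a\sigma(a)}<0$ and $\epsilon_a=1$ otherwise. Let $H=\{(a,m)\mid a\in I_\sigma,\ m\in\mathbb Z_{\ge1}\}$, and let $\mathcal N$ be the set of families $(N^{(a)}_m)_{(a,m)\in H}$ of non-negative integers with finite sum. For $\nu,N\in\mathcal N$ put $H'=\{(a,m)\in H\mid N^{(a)}_m>0\}$, $\gamma^{(a)}_m=\sum_{k\ge1}\min(m,k)\,\nu^{(a)}_k$, $$P^{(a)}_m=P^{(a)}_m(\nu,N)=\gamma^{(a)}_m-\sum_{(b,k)\in H}\frac{A_{ab}}{\epsilon_ad'_b}\min(d'_am,d'_bk)N^{(b)}_k,\qquad \hat P^{(a)}_m=\gamma^{(a)}_m-\sum_{(b,k)\in H}\frac{A'_{ab}}{d'_b}\min(d'_am,d'_bk)N^{(b)}_k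 .$$ For $(a,m),(b,k)\in H'$, $1\le\alpha\le N^{(a)}_m$ and $1\le\beta\le N^{(b)}_k$ put $$A_{am\alpha,bk\beta}=\delta_{ab}\delta_{mk}\delta_{\alpha\beta}(P^{(a)}_m+N^{(a)}_m)+\frac{A_{ba}}{\epsilon_bd'_a}\min(d'_am,d'_bk)-\delta_{ab}\delta_{mk}.$$ All these quantities are integers. The *string center equation* (SCE) of pattern $N$ is the system $$\prod_{(b,k)\in H'}\prod_{\beta=1}^{N^{(b)}_k}\bigl(z^{(b)}_{k\beta}\bigr)^{A_{am\alpha,bk\beta}}=(-1)^{\hat P^{(a)}_m+N^{(a)}_m+1}\qquad\bigl((a,m)\in H',\ 1\le\alpha\le N^{(a)}_m\bigr)$$ for unknowns $z^{(a)}_{m\alpha}\in\mathbb C^\times$ ($(a,m)\in H'$, $1\le\alpha\le N^{(a)}_m$). A solution is *off-diagonal* if $z^{(a)}_{m\alpha}=z^{(a)}_{m\beta}$ only for $\alpha=\beta$. Put $$R(\nu,N)=\Bigl(\det_{(a,m),(b,k)\in H'}F_{am,bk}\Bigr)\prod_{(a,m)\in H'}\frac1{N^{(a)}_m}\binom{P^{(a)}_m+N^{(a)}_m-1}{N^{(a)}_m-1},\qquad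 F_{am,bk}=\delta_{ab}\delta_{mk}P^{(a)}_m+\frac{A_{ba}}{\epsilon_bd'_a}\min(d'_am,d'_bk)N^{(b)}_k,$$ with $R(\nu,0)=1$. **Theorem.** Let $\nu,N\in\mathcal N$ and suppose that $P^{(a)}_m(\nu,N)\ge0$ for every $(a,m)\in H'$. Then the number of off-diagonal solutions of the SCE of pattern $N$ is finite, and this number divided by $\prod_{(a,m)\in H'}N^{(a)}_m!$ is equal to $R(\nu,N)$. -/

import Mathlib

namespace SCE

open scoped Matrix

/-- The affine types `X_N^{(r)}`. -/
inductive AffineType where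
  /-- `A_n^{(1)}`, `n ≥ 1` -/
  | A1 (n : ℕ) (h : 1 ≤ n)
  /-- `B_n^{(1)}`, `n ≥ 3` -/
  | B1 (n : ℕ) (h : 3 ≤ n)
  /-- `C_n^{(1)}`, `n ≥ 2` -/
  | C1 (n : ℕ) (h : 2 ≤ n)
  /-- `D_n^{(1)}`, `n ≥ 4` -/
  | D1 (n : ℕ) (h : 4 ≤ n)
  /-- `E_6^{(1)}` -/
  | E61
  /-- `E_7^{(1)}` -/
  | E71
  /-- `E_8^{(1)}` -/
  | E81
  /-- `F_4^{(1)}` -/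
  | F41
  /-- `G_2^{(1)}` -/
  | G21
  /-- `A_{2n}^{(2)}`, `n ≥ 1` -/
  | A2even (n : ℕ) (h : 1 ≤ n)
  /-- `A_{2n-1}^{(2)}`, `n ≥ 2` -/
  | A2odd (n : ℕ) (h : 2 ≤ n)
  /-- `D_{n+1}^{(2)}`, `n ≥ 2` -/
  | D2 (n : ℕ) (h : 2 ≤ n)
  /-- `E_6^{(2)}` -/
  | E62
  /-- `D_4^{(3)}` -/
  | D43

/-- The Cartan matrix of `E_6`: the chain `1-2-3-5-6`, with `4` joined to `3`. -/
def cartanE6 : Matrix (Fin 6) (Fin 6) ℤ :=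
  !![ 2, -1,  0,  0,  0,  0;
     -1,  2, -1,  0,  0,  0;
      0, -1,  2, -1, -1,  0;
      0,  0, -1,  2,  0,  0;
      0,  0, -1,  0,  2, -1;
      0,  0,  0,  0, -1,  2]

/-- The Cartan matrix of `E_7`: the chain `1-2-3-4-5-6`, with `7` joined to `3`. -/
def cartanE7 : Matrix (Fin 7) (Fin 7) ℤ :=
  !![ 2, -1,  0,  0,  0,  0,  0;
     -1,  2, -1,  0,  0,  0,  0;
      0, -1,  2, -1,  0,  0, -1;
      0,  0, -1,  2, -1,  0,  0;
      0,  0,  0, -1,  2, -1,  0;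
      0,  0,  0,  0, -1,  2,  0;
      0,  0, -1,  0,  0,  0,  2]

/-- The Cartan matrix of `E_8`: the chain `1-2-3-4-5-6-7`, with `8` joined to `5`. -/
def cartanE8 : Matrix (Fin 8) (Fin 8) ℤ :=
  !![ 2, -1,  0,  0,  0,  0,  0,  0;
     -1,  2, -1,  0,  0,  0,  0,  0;
      0, -1,  2, -1,  0,  0,  0,  0;
      0,  0, -1,  2, -1,  0,  0,  0;
      0,  0,  0, -1,  2, -1,  0, -1;
      0,  0,  0,  0, -1,  2, -1,  0;
      0,  0,  0,  0,  0, -1,  2,  0;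
      0,  0,  0,  0, -1,  0,  0,  2]

namespace AffineType

/-- The rank `N` of `𝔤 = X_N`; its Dynkin nodes `I` are `Fin N` (the node `i` is `i - 1` here). -/
def bigRank : AffineType → ℕ
  | A1 n _ => n
  | B1 n _ => n
  | C1 n _ => n
  | D1 n _ => n
  | E61 => 6
  | E71 => 7
  | E81 => 8
  | F41 => 4
  | G21 => 2
  | A2even n _ => 2 * n
  | A2odd n _ => 2 * n - 1
  | D2 n _ => n + 1
  | E62 => 6
  | D43 => 4

/-- The rank `n` of `𝔤₀`; its Dynkin nodes, the `σ`-orbits in `I`, are `Fin n`. -/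
def rank : AffineType → ℕ
  | A1 n _ => n
  | B1 n _ => n
  | C1 n _ => n
  | D1 n _ => n
  | E61 => 6
  | E71 => 7
  | E81 => 8
  | F41 => 4
  | G21 => 2
  | A2even n _ => n
  | A2odd n _ => n
  | D2 n _ => n
  | E62 => 4
  | D43 => 2

theorem rank_le_bigRank (t : AffineType) : t.rank ≤ t.bigRank := by
  cases t <;> simp only [rank, bigRank] <;> omega

/-- The representative `ι(a) = a` in `I` of the orbit `a`. -/
def iota (t : AffineType) : Fin t.rank → Fin t.bigRank :=
  Fin.castLE t.rank_le_bigRank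

/-- The Cartan matrix `A'` of `𝔤 = X_N`. The convention is that `d_i A_{ij}` is symmetric with `d_i`
proportional to the squared length of the root `α_i`, so that the matrices of the non-simply-laced
types are the transposes of Mathlib's. -/
def cartanBig : (t : AffineType) → Matrix (Fin t.bigRank) (Fin t.bigRank) ℤ
  | A1 n _ => CartanMatrix.A n
  | B1 n _ => (CartanMatrix.B n)ᵀ
  | C1 n _ => (CartanMatrix.C n)ᵀ
  | D1 n _ => CartanMatrix.D n
  | E61 => cartanE6
  | E71 => cartanE7
  | E81 => cartanE8
  | F41 => CartanMatrix.F₄ᵀ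
  | G21 => CartanMatrix.G₂ᵀ
  | A2even n _ => CartanMatrix.A (2 * n)
  | A2odd n _ => CartanMatrix.A (2 * n - 1)
  | D2 n _ => CartanMatrix.D (n + 1)
  | E62 => cartanE6
  | D43 => CartanMatrix.D 4

/-- The Cartan matrix `A` of `𝔤₀`, in the same convention. For `E_6^{(2)}` and `D_4^{(3)}` the
labelling by `σ`-orbits puts the short roots first, so that no transpose appears. -/
def cartan : (t : AffineType) → Matrix (Fin t.rank) (Fin t.rank) ℤ
  | A1 n _ => CartanMatrix.A n
  | B1 n _ => (CartanMatrix.B n)ᵀ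
  | C1 n _ => (CartanMatrix.C n)ᵀ
  | D1 n _ => CartanMatrix.D n
  | E61 => cartanE6
  | E71 => cartanE7
  | E81 => cartanE8
  | F41 => CartanMatrix.F₄ᵀ
  | G21 => CartanMatrix.G₂ᵀ
  | A2even n _ => (CartanMatrix.B n)ᵀ
  | A2odd n _ => (CartanMatrix.C n)ᵀ
  | D2 n _ => (CartanMatrix.B n)ᵀ
  | E62 => CartanMatrix.F₄
  | D43 => CartanMatrix.G₂

/-- The diagram automorphism `σ` of `𝔤`, of order `r`. -/
def sigma : (t : AffineType) → Equiv.Perm (Fin t.bigRank)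
  | A1 _ _ | B1 _ _ | C1 _ _ | D1 _ _ | E61 | E71 | E81 | F41 | G21 => 1
  | A2even n _ => (Fin.revPerm : Equiv.Perm (Fin (2 * n)))
  | A2odd n _ => (Fin.revPerm : Equiv.Perm (Fin (2 * n - 1)))
  | D2 n _ => (Equiv.swap ⟨n - 1, by omega⟩ (Fin.last n) : Equiv.Perm (Fin (n + 1)))
  | E62 => (Equiv.swap 0 5 * Equiv.swap 1 4 : Equiv.Perm (Fin 6))
  | D43 => (Equiv.swap 0 2 * Equiv.swap 2 3 : Equiv.Perm (Fin 4))

/-- The coprime positive integers `d'_i` (`i ∈ I`) such that `d'_i A'_{ij}` is symmetric. -/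
def dBig : (t : AffineType) → Fin t.bigRank → ℕ
  | B1 n _ => fun i : Fin n => if i.val = n - 1 then 1 else 2
  | C1 n _ => fun i : Fin n => if i.val = n - 1 then 2 else 1
  | F41 => (![2, 2, 1, 1] : Fin 4 → ℕ)
  | G21 => (![3, 1] : Fin 2 → ℕ)
  | A1 _ _ | D1 _ _ | E61 | E71 | E81 | A2even _ _ | A2odd _ _ | D2 _ _ | E62 | D43 => fun _ => 1

/-- `d'_a` for `a ∈ I_σ`. -/
def d (t : AffineType) (a : Fin t.rank) : ℕ := t.dBig (t.iota a)

/-- `ε_a = 2` if `A'_{a σ(a)} < 0`, and `1` otherwise. -/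
def eps (t : AffineType) (a : Fin t.rank) : ℕ :=
  if t.cartanBig (t.iota a) (t.sigma (t.iota a)) < 0 then 2 else 1

/-- `H = I_σ × ℤ_{≥ 1}`. -/
abbrev H (t : AffineType) : Type := Fin t.rank × ℕ+

/-- `𝒩`: the families of non-negative integers indexed by `H` with finite sum. -/
abbrev Pattern (t : AffineType) : Type := t.H →₀ ℕ

/-- `min(d'_a m, d'_b k)`. -/
def minD (t : AffineType) (p q : t.H) : ℤ :=
  min ((t.d p.1 : ℤ) * (p.2 : ℕ)) ((t.d q.1 : ℤ) * (q.2 : ℕ))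

/-- `d'_i A'_{ij}` is symmetric. -/
theorem dBig_mul_cartanBig (t : AffineType) (i j : Fin t.bigRank) :
    (t.dBig i : ℤ) * t.cartanBig i j = t.dBig j * t.cartanBig j i := by
  cases t with
  | A1 n h => simpa [dBig, cartanBig] using (CartanMatrix.A_isSymm n).apply j i
  | D1 n h => simpa [dBig, cartanBig] using (CartanMatrix.D_isSymm n).apply j i
  | A2even n h => simpa [dBig, cartanBig] using (CartanMatrix.A_isSymm (2 * n)).apply j i
  | A2odd n h => simpa [dBig, cartanBig] using (CartanMatrix.A_isSymm (2 * n - 1)).apply j i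
  | D2 n h => simpa [dBig, cartanBig] using (CartanMatrix.D_isSymm (n + 1)).apply j i
  | B1 n h =>
    revert i j
    change ∀ i j : Fin n, ((if i.val = n - 1 then 1 else 2 : ℕ) : ℤ) * CartanMatrix.B n j i =
      ((if j.val = n - 1 then 1 else 2 : ℕ) : ℤ) * CartanMatrix.B n i j
    intro i j
    simp only [CartanMatrix.B, Matrix.of_apply]
    grind
  | C1 n h =>
    revert i j
    change ∀ i j : Fin n, ((if i.val = n - 1 then 2 else 1 : ℕ) : ℤ) * CartanMatrix.C n j i =
      ((if j.val = n - 1 then 2 else 1 : ℕ) : ℤ) * CartanMatrix.C n i j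
    intro i j
    simp only [CartanMatrix.C, Matrix.of_apply]
    grind
  | E61 => revert i j; decide
  | E71 => revert i j; decide
  | E81 => revert i j; decide
  | F41 => revert i j; decide
  | G21 => revert i j; decide
  | E62 => revert i j; decide
  | D43 => revert i j; decide

/-- The positive integers `d'_i` are coprime: one of them is `1`. -/
theorem exists_dBig_eq_one (t : AffineType) : ∃ i, t.dBig i = 1 := by
  cases t with
  | A1 n h => exact ⟨(⟨0, by omega⟩ : Fin n), rfl⟩
  | D1 n h => exact ⟨(⟨0, by omega⟩ : Fin n), rfl⟩
  | A2even n h => exact ⟨(⟨0, by omega⟩ : Fin (2 * n)), rfl⟩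
  | A2odd n h => exact ⟨(⟨0, by omega⟩ : Fin (2 * n - 1)), rfl⟩
  | D2 n h => exact ⟨(0 : Fin (n + 1)), rfl⟩
  | B1 n h => exact ⟨(⟨n - 1, by omega⟩ : Fin n), by simp [dBig]⟩
  | C1 n h => exact ⟨(⟨0, by omega⟩ : Fin n), if_neg (by simp; omega)⟩
  | E61 => decide
  | E71 => decide
  | E81 => decide
  | F41 => decide
  | G21 => decide
  | E62 => decide
  | D43 => decide

theorem dBig_cases (t : AffineType) (i j : Fin t.bigRank) :
    t.dBig i = t.dBig j ∨ t.dBig i = 1 ∨ t.dBig j = 1 := by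
  cases t with
  | B1 n h => change Fin n at i j; simp only [dBig]; grind
  | C1 n h => change Fin n at i j; simp only [dBig]; grind
  | F41 => revert i j; decide
  | G21 => revert i j; decide
  | _ => exact Or.inl rfl

/-- `A'_{ab} min(d'_a m, d'_b k) / d'_b` is an integer. -/
theorem d_dvd_cartanBig_mul (t : AffineType) (p q : t.H) :
    (t.d q.1 : ℤ) ∣ t.cartanBig (t.iota p.1) (t.iota q.1) * t.minD p q := by
  have hs := t.dBig_mul_cartanBig (t.iota p.1) (t.iota q.1)
  have hc := t.dBig_cases (t.iota p.1) (t.iota q.1)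
  unfold minD
  change (t.d p.1 : ℤ) * _ = t.d q.1 * _ at hs
  change t.d p.1 = t.d q.1 ∨ t.d p.1 = 1 ∨ t.d q.1 = 1 at hc
  rcases hc with hc | hc | hc
  · rw [hc, ← mul_min_of_nonneg _ _ (Int.natCast_nonneg _)]
    exact Dvd.dvd.mul_left (dvd_mul_right _ _) _
  · rw [hc, Nat.cast_one, one_mul] at hs
    exact Dvd.dvd.mul_right ⟨_, hs⟩ _
  · rw [hc, Nat.cast_one]; exact one_dvd _

/-- `ε_a` divides `A_{ab}`; moreover all `d'` are `1`, or else `ε_a = 1` and `A_{ab} = A'_{ab}`. -/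
theorem eps_dvd_cartan (t : AffineType) (a b : Fin t.rank) :
    ((t.eps a : ℤ) ∣ t.cartan a b) ∧
      ((∀ i, t.dBig i = 1) ∨
        (t.eps a = 1 ∧ t.cartan a b = t.cartanBig (t.iota a) (t.iota b))) := by
  have key : ∀ s : AffineType, ∀ x : Fin s.rank,
      0 ≤ s.cartanBig (s.iota x) (s.sigma (s.iota x)) → s.eps x = 1 :=
    fun s x h => if_neg (not_lt.mpr h)
  have one : ∀ s : AffineType, ∀ x y : Fin s.rank,
      s.eps x = 1 → (s.eps x : ℤ) ∣ s.cartan x y :=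
    fun s x y h => by rw [h, Nat.cast_one]; exact one_dvd _
  cases t with
  | A1 n h =>
    have h1 := key (A1 n h) a (le_of_le_of_eq (zero_le_two (α := ℤ)) (congrFun (CartanMatrix.A_diag n) a).symm)
    exact ⟨one _ _ _ h1, Or.inr ⟨h1, rfl⟩⟩
  | B1 n h =>
    have h1 := key (B1 n h) a (le_of_le_of_eq (zero_le_two (α := ℤ)) (CartanMatrix.B_diag n a).symm)
    exact ⟨one _ _ _ h1, Or.inr ⟨h1, rfl⟩⟩
  | C1 n h =>
    have h1 := key (C1 n h) a (le_of_le_of_eq (zero_le_two (α := ℤ)) (CartanMatrix.C_diag n a).symm)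
    exact ⟨one _ _ _ h1, Or.inr ⟨h1, rfl⟩⟩
  | D1 n h =>
    have h1 := key (D1 n h) a (le_of_le_of_eq (zero_le_two (α := ℤ)) (CartanMatrix.D_diag n a).symm)
    exact ⟨one _ _ _ h1, Or.inr ⟨h1, rfl⟩⟩
  | E61 =>
    have h0 : ∀ x, 0 ≤ E61.cartanBig (E61.iota x) (E61.sigma (E61.iota x)) := by decide
    have h1 := key E61 a (h0 a)
    exact ⟨one _ _ _ h1, Or.inr ⟨h1, rfl⟩⟩
  | E71 =>
    have h0 : ∀ x, 0 ≤ E71.cartanBig (E71.iota x) (E71.sigma (E71.iota x)) := by decide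
    have h1 := key E71 a (h0 a)
    exact ⟨one _ _ _ h1, Or.inr ⟨h1, rfl⟩⟩
  | E81 =>
    have h0 : ∀ x, 0 ≤ E81.cartanBig (E81.iota x) (E81.sigma (E81.iota x)) := by decide
    have h1 := key E81 a (h0 a)
    exact ⟨one _ _ _ h1, Or.inr ⟨h1, rfl⟩⟩
  | F41 =>
    have h0 : ∀ x, 0 ≤ F41.cartanBig (F41.iota x) (F41.sigma (F41.iota x)) := by decide
    have h1 := key F41 a (h0 a)
    exact ⟨one _ _ _ h1, Or.inr ⟨h1, rfl⟩⟩
  | G21 =>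
    have h0 : ∀ x, 0 ≤ G21.cartanBig (G21.iota x) (G21.sigma (G21.iota x)) := by decide
    have h1 := key G21 a (h0 a)
    exact ⟨one _ _ _ h1, Or.inr ⟨h1, rfl⟩⟩
  | E62 =>
    have h0 : ∀ x, 0 ≤ E62.cartanBig (E62.iota x) (E62.sigma (E62.iota x)) := by decide
    have h1 := key E62 a (h0 a)
    exact ⟨one _ _ _ h1, Or.inl fun _ => rfl⟩
  | D43 =>
    have h0 : ∀ x, 0 ≤ D43.cartanBig (D43.iota x) (D43.sigma (D43.iota x)) := by decide
    have h1 := key D43 a (h0 a)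
    exact ⟨one _ _ _ h1, Or.inl fun _ => rfl⟩
  | A2even n h =>
    refine ⟨?_, Or.inl fun _ => rfl⟩
    revert a b
    change ∀ a b : Fin n, (((if CartanMatrix.A (2 * n) (Fin.castLE (by omega) a)
      (Fin.rev (Fin.castLE (by omega) a)) < 0 then 2 else 1 : ℕ)) : ℤ) ∣ CartanMatrix.B n b a
    intro a b
    simp only [CartanMatrix.A, CartanMatrix.B, Matrix.of_apply, Fin.ext_iff, Fin.val_rev,
      Fin.val_castLE]
    have ha := a.isLt
    have hb := b.isLt
    by_cases e : a.val = n - 1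
    · have h2 : ¬ (a.val + 1 = b.val) := by omega
      by_cases e1 : b.val = a.val
      · rw [if_pos e1]
        split_ifs <;> simp
      · rw [if_neg e1]
        by_cases e2 : b.val + 1 = a.val
        · rw [if_pos e2, if_pos e]
          split_ifs <;> simp
        · rw [if_neg e2, if_neg h2]
          simp
    · have h3 : ¬ (a.val = 2 * n - (a.val + 1)) := by omega
      have h4 : ¬ (a.val + 1 = 2 * n - (a.val + 1) ∨ 2 * n - (a.val + 1) + 1 = a.val) := by omega
      rw [if_neg h3, if_neg h4]
      simp
  | A2odd n h =>
    have h1 := key (A2odd n h) a (by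
      clear b
      revert a
      change ∀ a : Fin n, (0 : ℤ) ≤ CartanMatrix.A (2 * n - 1) (Fin.castLE (by omega) a)
        (Fin.rev (Fin.castLE (by omega) a))
      intro a
      simp only [CartanMatrix.A, Matrix.of_apply, Fin.ext_iff, Fin.val_rev, Fin.val_castLE]
      have ha := a.isLt
      rw [if_neg (c := _ ∨ _) (by omega)]
      split_ifs <;> simp)
    exact ⟨one _ _ _ h1, Or.inl fun _ => rfl⟩
  | D2 n h =>
    have h1 := key (D2 n h) a (by
      clear b
      revert a
      change ∀ a : Fin n, (0 : ℤ) ≤ CartanMatrix.D (n + 1) (Fin.castLE (by omega) a)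
        (Equiv.swap ⟨n - 1, by omega⟩ (Fin.last n) (Fin.castLE (by omega) a))
      intro a
      have ha := a.isLt
      by_cases e : a.val = n - 1
      · have : (Fin.castLE (by omega) a : Fin (n + 1)) = ⟨n - 1, by omega⟩ := Fin.ext e
        rw [this, Equiv.swap_apply_left]
        simp only [CartanMatrix.D, Matrix.of_apply, Fin.ext_iff, Fin.val_last]
        split_ifs <;> omega
      · rw [Equiv.swap_apply_of_ne_of_ne (fun h => e (by simpa using congrArg Fin.val h))
          (fun h => by have := congrArg Fin.val h; simp at this; omega)]
        simp)
    exact ⟨one _ _ _ h1, Or.inl fun _ => rfl⟩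

/-- `A_{ab} min(d'_a m, d'_b k) / (ε_a d'_b)` is an integer. -/
theorem eps_mul_d_dvd_cartan_mul (t : AffineType) (p q : t.H) :
    ((t.eps p.1 : ℤ) * t.d q.1) ∣ t.cartan p.1 q.1 * t.minD p q := by
  obtain ⟨h, h1 | ⟨h1, h2⟩⟩ := t.eps_dvd_cartan p.1 q.1
  · have : t.d q.1 = 1 := h1 _
    rw [this, Nat.cast_one, mul_one]
    exact Dvd.dvd.mul_right h _
  · rw [h1, h2, Nat.cast_one, one_mul]
    exact t.d_dvd_cartanBig_mul p q

/-- The integer `A_{ab} min(d'_a m, d'_b k) / (ε_a d'_b)` for `p = (a, m)` and `q = (b, k)`. The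
division is exact (`cast_coef`). -/
def coef (t : AffineType) (p q : t.H) : ℤ :=
  t.cartan p.1 q.1 * t.minD p q / ((t.eps p.1 : ℤ) * t.d q.1)

/-- The integer `A'_{ab} min(d'_a m, d'_b k) / d'_b` for `p = (a, m)` and `q = (b, k)`. The
division is exact (`cast_coefHat`). -/
def coefHat (t : AffineType) (p q : t.H) : ℤ :=
  t.cartanBig (t.iota p.1) (t.iota q.1) * t.minD p q / t.d q.1

theorem d_pos (t : AffineType) (a : Fin t.rank) : 0 < t.d a := by
  obtain ⟨j, hj⟩ := t.exists_dBig_eq_one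
  unfold d
  generalize t.iota a = i
  cases t with
  | B1 n h => change Fin n at i; simp only [dBig]; grind
  | C1 n h => change Fin n at i; simp only [dBig]; grind
  | F41 => clear hj j; revert i; decide
  | G21 => clear hj j; revert i; decide
  | _ => exact Nat.one_pos

theorem eps_pos (t : AffineType) (a : Fin t.rank) : 0 < t.eps a := by
  unfold eps; split_ifs <;> norm_num

theorem cast_coef (t : AffineType) (p q : t.H) :
    (t.coef p q : ℚ) = (t.cartan p.1 q.1 : ℚ) / (t.eps p.1 * t.d q.1) * t.minD p q := by
  have h1 : ((t.eps p.1 : ℤ) * t.d q.1 : ℤ) ≠ 0 :=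
    mul_ne_zero (by exact_mod_cast (t.eps_pos _).ne') (by exact_mod_cast (t.d_pos _).ne')
  rw [coef, Int.cast_div (t.eps_mul_d_dvd_cartan_mul p q) (by exact_mod_cast h1)]
  push_cast
  ring

theorem cast_coefHat (t : AffineType) (p q : t.H) :
    (t.coefHat p q : ℚ) =
      (t.cartanBig (t.iota p.1) (t.iota q.1) : ℚ) / t.d q.1 * t.minD p q := by
  have h1 : (t.d q.1 : ℤ) ≠ 0 := by exact_mod_cast (t.d_pos _).ne'
  rw [coefHat, Int.cast_div (t.d_dvd_cartanBig_mul p q) (by exact_mod_cast h1)]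
  push_cast
  ring

end AffineType

open AffineType

variable {t : AffineType}

/-- `γ^{(a)}_m(ν) = ∑_{k ≥ 1} min(m, k) ν^{(a)}_k` for `p = (a, m)`. -/
def gamma (ν : t.Pattern) (p : t.H) : ℤ :=
  ν.sum fun q c => if q.1 = p.1 then ((min p.2 q.2 : ℕ+) : ℤ) * c else 0

/-- `P^{(a)}_m(ν, N)` for `p = (a, m)`. -/
def P (ν N : t.Pattern) (p : t.H) : ℤ :=
  gamma ν p - N.sum fun q c => t.coef p q * c

/-- `P̂^{(a)}_m(ν, N)` for `p = (a, m)`. -/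
def PHat (ν N : t.Pattern) (p : t.H) : ℤ :=
  gamma ν p - N.sum fun q c => t.coefHat p q * c

/-- The index set of the string centers: the triples `(a, m, α)` with `(a, m) ∈ H'(N)`, i.e.
`N^{(a)}_m > 0`, and `1 ≤ α ≤ N^{(a)}_m`. -/
abbrev Idx (N : t.Pattern) : Type := Σ p : N.support, Fin (N p)

/-- The exponent `A_{amα, bkβ} = δ_{ab} δ_{mk} δ_{αβ} (P^{(a)}_m + N^{(a)}_m)
+ A_{ba} min(d'_a m, d'_b k) / (ε_b d'_a) - δ_{ab} δ_{mk}`. -/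
def expo (ν N : t.Pattern) (i j : Idx N) : ℤ :=
  (if i = j then P ν N i.1 + N i.1 else 0) + t.coef j.1 i.1 - (if i.1 = j.1 then 1 else 0)

/-- `z` is a solution of the string center equation of pattern `N`. -/
def IsSolution (ν N : t.Pattern) (z : Idx N → ℂˣ) : Prop :=
  ∀ i : Idx N, ∏ j : Idx N, z j ^ expo ν N i j = (-1 : ℂˣ) ^ (PHat ν N i.1 + N i.1 + 1)

/-- `z^{(a)}_{mα} = z^{(a)}_{mβ}` only for `α = β`. -/
def IsOffDiagonal (N : t.Pattern) (z : Idx N → ℂˣ) : Prop :=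
  ∀ (p : N.support) (α β : Fin (N p)), z ⟨p, α⟩ = z ⟨p, β⟩ → α = β

/-- The set of the off-diagonal solutions of the string center equation of pattern `N`. -/
def offDiagonalSolutions (ν N : t.Pattern) : Set (Idx N → ℂˣ) :=
  {z | IsSolution ν N z ∧ IsOffDiagonal N z}

/-- The matrix `F_{am, bk} = δ_{ab} δ_{mk} P^{(a)}_m + A_{ba} min(d'_a m, d'_b k) N^{(b)}_k / (ε_b d'_a)`,
with rows and columns indexed by `H'(N)`. -/
def F (ν N : t.Pattern) : Matrix N.support N.support ℤ :=
  Matrix.of fun p q => (if p = q then P ν N p else 0) + t.coef q p * N q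

/-- The number `R(ν, N)`. Here `Ring.choose x j = x (x - 1) ⋯ (x - j + 1) / j!`. -/
noncomputable def R (ν N : t.Pattern) : ℚ :=
  ((F ν N).det : ℚ) *
    ∏ p : N.support, (1 / (N p : ℚ)) * (Ring.choose (P ν N p + N p - 1) (N p - 1) : ℤ)

/-- The empty determinant and product give `R(ν, 0) = 1`. -/
theorem R_zero (ν : t.Pattern) : R ν (0 : t.Pattern) = 1 := by
  simp [R]

/-- `F_{am, bk} = ∑_β A_{amα, bkβ}` for every `α`. -/
theorem F_eq_sum (ν N : t.Pattern) (p q : N.support) (α : Fin (N p)) :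
    F ν N p q = ∑ β : Fin (N q), expo ν N ⟨p, α⟩ ⟨q, β⟩ := by
  by_cases h : p = q
  · subst h
    simp [F, expo, Finset.sum_add_distrib, Finset.sum_sub_distrib]
    ring
  · simp [F, expo, h, mul_comm]

end SCE

open scoped Matrix

/-! Apart from its `δ_{αβ}` term, the exponent matrix is constant on the blocks `(a, m), (b, k)`. So
the equation at `(a, m, α)` says that `z_α ^ X`, with `X = P + N ≥ 1`, times a monomial in the block
products equals a sign, and only the first factor depends on `α`. Within a block the ratios `z_α /
z_1` are therefore `X`-th roots of unity. Off-diagonality says that they are distinct, which leaves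
`(X - 1)(X - 2) ⋯ (X - N + 1)` choices per block.

Once the ratios are fixed, the first components satisfy a monomial system with exponent matrix `F`,
whose right-hand side depends on the ratios. A monomial system on a torus over an algebraically
closed field of characteristic zero has `|det F|` solutions for every right-hand side, provided `det
F ≠ 0` (`Matrix.card_torusHom_eq`). Hence the two counts multiply (`natCard_distinctSolutions`), the
signs in the SCE play no role, and division by `∏ N!` turns the falling factorials into the
binomials of `R`.

It remains to see that `det F > 0` (`SCE.det_F_pos`), which gives solvability and also removes the
absolute value. Positive rescalings of rows and columns turn `F` into a non-negative diagonal matrix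
(here `P ≥ 0` enters) plus the matrix `S_{ab} min(d'_a m, d'_b k)`, where `S` is the symmetrized
Cartan matrix of `𝔤₀`. The form `S` is positive definite because the Cartan matrix sends some
positive vector to a positive vector. The kernel `min` is a sum over levels of products of indicator
functions, so its product with `S` is a sum of values of the form `S` (`sum_mul_min_mul_pos`). -/

theorem Finset.prod_zpow_eq_zpow_sum {ι G : Type*} [CommGroup G] (s : Finset ι) (f : ι → ℤ) (g : G) :
    ∏ i ∈ s, g ^ f i = g ^ ∑ i ∈ s, f i := by
  classical
  induction s using Finset.induction_on with
  | empty => simp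
  | insert i s hi ih => rw [Finset.prod_insert hi, Finset.sum_insert hi, zpow_add, ih]

/-! ### Monomial systems on an algebraic torus -/

section MonomialSystem

variable {ι K : Type*} [Fintype ι] [Field K]

/-- The endomorphism `z ↦ (∏ j, z j ^ M i j)_i` of the torus `(Kˣ)^ι` attached to an integer
matrix `M`. -/
def Matrix.torusHom (K : Type*) [Field K] (M : Matrix ι ι ℤ) : (ι → Kˣ) →* (ι → Kˣ) where
  toFun z i := ∏ j, z j ^ M i j
  map_one' := by ext; simp
  map_mul' z w := by
    funext i
    simp [mul_zpow, Finset.prod_mul_distrib]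

theorem Matrix.torusHom_apply (M : Matrix ι ι ℤ) (z : ι → Kˣ) (i : ι) :
    M.torusHom K z i = ∏ j, z j ^ M i j := rfl

theorem Matrix.torusHom_torusHom (M M' : Matrix ι ι ℤ) (z : ι → Kˣ) :
    M.torusHom K (M'.torusHom K z) = (M * M').torusHom K z := by
  funext i
  simp only [Matrix.torusHom_apply, Matrix.mul_apply, ← Finset.prod_zpow]
  rw [Finset.prod_comm]
  refine Finset.prod_congr rfl fun j _ => ?_
  rw [← Finset.prod_zpow_eq_zpow_sum]
  exact Finset.prod_congr rfl fun k _ => by rw [mul_comm]; exact (_root_.zpow_mul _ _ _).symm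

variable [DecidableEq ι]

theorem Matrix.torusHom_smul_one (c : ℤ) (z : ι → Kˣ) :
    (c • (1 : Matrix ι ι ℤ)).torusHom K z = z ^ c := by
  funext i
  rw [Matrix.torusHom_apply, Finset.prod_eq_single i]
  · simp
  · intro j _ hj
    simp [Matrix.one_apply_ne' hj]
  · simp

theorem Units.exists_zpow_eq [IsAlgClosed K] {c : ℤ} (hc : c ≠ 0) (w : Kˣ) :
    ∃ y : Kˣ, y ^ c = w := by
  have key : ∀ w : Kˣ, ∃ y : Kˣ, y ^ c.natAbs = w := fun w => by
    obtain ⟨y, hy⟩ := IsAlgClosed.exists_pow_nat_eq (w : K) (Int.natAbs_pos.mpr hc)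
    have hy0 : y ≠ 0 := by
      rintro rfl
      rw [zero_pow (Int.natAbs_ne_zero.mpr hc)] at hy
      exact w.ne_zero hy.symm
    exact ⟨Units.mk0 y hy0, Units.ext (by simpa using hy)⟩
  obtain ⟨y, hy⟩ := key w
  rcases Int.natAbs_eq c with h | h
  · exact ⟨y, by rw [h, zpow_natCast, hy]⟩
  · exact ⟨y⁻¹, by rw [h, zpow_neg, inv_zpow, inv_inv, zpow_natCast, hy]⟩

/-- Since `M * adj M = det M • 1`, a preimage of `w` is obtained by applying `adj M` to a tuple of
`det M`-th roots of the components of `w`. -/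
theorem Matrix.torusHom_surjective [IsAlgClosed K] {M : Matrix ι ι ℤ} (hM : M.det ≠ 0) :
    Function.Surjective (M.torusHom K) := by
  intro w
  choose y hy using fun i => Units.exists_zpow_eq hM (w i)
  refine ⟨M.adjugate.torusHom K y, ?_⟩
  rw [Matrix.torusHom_torusHom, Matrix.mul_adjugate, Matrix.torusHom_smul_one]
  exact funext hy

theorem Matrix.card_quotient_range_transpose {M : Matrix ι ι ℤ} (hM : M.det ≠ 0) :
    Nat.card ((ι → ℤ) ⧸ LinearMap.range (Matrix.toLin' Mᵀ)) = M.det.natAbs := by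
  have hinj : Function.Injective (Matrix.toLin' Mᵀ) :=
    Matrix.mulVec_injective_of_det_ne_zero (by rwa [Matrix.det_transpose])
  rw [← Submodule.natAbs_det_equiv _ (LinearEquiv.ofInjective _ hinj)]
  rw [← Matrix.det_transpose M, ← LinearMap.det_toLin' Mᵀ]
  rfl

/-- The kernel of `M.torusHom` is the character group of `ℤ^ι / Mᵀ ℤ^ι`. -/
theorem Matrix.card_ker_torusHom [IsAlgClosed K] [CharZero K] {M : Matrix ι ι ℤ}
    (hM : M.det ≠ 0) : Nat.card (M.torusHom K).ker = M.det.natAbs := by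
  set N := LinearMap.range (Matrix.toLin' Mᵀ) with hN
  have hcard : Nat.card (Multiplicative ((ι → ℤ) ⧸ N)) = M.det.natAbs :=
    Matrix.card_quotient_range_transpose hM
  have : Finite (Multiplicative ((ι → ℤ) ⧸ N)) :=
    Nat.finite_of_card_ne_zero (by rw [hcard]; exact Int.natAbs_ne_zero.mpr hM)
  -- A nonzero exponent is what makes `K` contain enough roots of unity for the finite group and its
  -- character group to have the same order.
  have : NeZero (Monoid.exponent (Multiplicative ((ι → ℤ) ⧸ N))) :=
    ⟨Monoid.exponent_ne_zero_of_finite⟩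
  rw [← hcard, ← CommGroup.card_monoidHom_of_hasEnoughRootsOfUnity
    (Multiplicative ((ι → ℤ) ⧸ N)) K]
  -- A point `z` of the torus is the character `x ↦ z ^ x` of `ℤ^ι`. It lies in the kernel exactly
  -- when this character is trivial on the rows of `M`, which generate `N`; this is why the
  -- transpose appears.
  let pt (z : ι → Kˣ) : (ι → ℤ) →+ Additive Kˣ :=
    { toFun := fun x => Additive.ofMul (∏ j, z j ^ x j)
      map_zero' := by simp
      map_add' := fun x y => by
        rw [← ofMul_mul, ← Finset.prod_mul_distrib]
        exact congrArg _ (Finset.prod_congr rfl fun j _ => _root_.zpow_add (z j) (x j) (y j)) }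
  have row (i : ι) : M i ∈ N := ⟨Pi.single i 1, by
    ext j; simp [Matrix.toLin'_apply]⟩
  have basis (x : ι → ℤ) : x = ∑ j, x j • (Pi.single j 1 : ι → ℤ) := by
    ext k; simp [Finset.sum_apply, Pi.single_apply]
  have val (χ : Multiplicative ((ι → ℤ) ⧸ N) →* Kˣ) (x : ι → ℤ) :
      χ (Multiplicative.ofAdd (N.mkQ x)) =
        ∏ j, χ (Multiplicative.ofAdd (N.mkQ (Pi.single j 1))) ^ x j := by
    conv_lhs => rw [basis x, map_sum, ofAdd_sum, map_prod]
    refine Finset.prod_congr rfl fun j _ => ?_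
    rw [map_zsmul, ofAdd_zsmul, map_zpow]
  refine (Nat.card_congr (Equiv.ofBijective (fun χ : Multiplicative ((ι → ℤ) ⧸ N) →* Kˣ =>
    (⟨fun j => χ (Multiplicative.ofAdd (N.mkQ (Pi.single j 1))), ?_⟩ :
      (M.torusHom K).ker)) ⟨?_, ?_⟩)).symm
  · rw [MonoidHom.mem_ker]
    funext i
    have hrow : N.mkQ (M i) = 0 := (Submodule.Quotient.mk_eq_zero N).mpr (row i)
    rw [Matrix.torusHom_apply, ← val, hrow, ofAdd_zero, map_one, Pi.one_apply]
  · intro χ χ' h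
    refine MonoidHom.ext fun q => ?_
    obtain ⟨x, hx⟩ := N.mkQ_surjective q.toAdd
    have hq : q = Multiplicative.ofAdd (N.mkQ x) := by rw [hx]; rfl
    rw [hq, val χ, val χ']
    refine Finset.prod_congr rfl fun j _ => ?_
    exact congrArg (· ^ x j) (congrFun (congrArg Subtype.val h) j)
  · rintro ⟨z, hz⟩
    have hker : ∀ x ∈ N.toAddSubgroup, pt z x = 0 := by
      rintro _ ⟨c, rfl⟩
      change Additive.ofMul _ = Additive.ofMul 1
      congr 1
      simp only [Matrix.toLin'_apply, Matrix.mulVec, dotProduct, Matrix.transpose_apply]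
      simp only [← Finset.prod_zpow_eq_zpow_sum]
      rw [Finset.prod_comm]
      refine Finset.prod_eq_one fun i _ => ?_
      have h : (∏ j, z j ^ M i j) ^ c i = 1 := by
        rw [show ∏ j, z j ^ M i j = 1 from congrFun (MonoidHom.mem_ker.mp hz) i]; exact _root_.one_zpow _
      rw [← h, ← Finset.prod_zpow]
      exact Finset.prod_congr rfl fun j _ => _root_.zpow_mul _ _ _
    refine ⟨AddMonoidHom.toMultiplicativeLeft (QuotientAddGroup.lift N.toAddSubgroup (pt z) hker),
      Subtype.ext (funext fun j => ?_)⟩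
    change ∏ k, z k ^ (Pi.single j 1 : ι → ℤ) k = z j
    rw [Finset.prod_eq_single j]
    · simp
    · intro k _ hk
      simp [hk]
    · simp

/-- By surjectivity the fibre is a coset of the kernel. -/
theorem Matrix.card_torusHom_eq [IsAlgClosed K] [CharZero K] {M : Matrix ι ι ℤ}
    (hM : M.det ≠ 0) (w : ι → Kˣ) : Nat.card {z // M.torusHom K z = w} = M.det.natAbs := by
  obtain ⟨z₀, rfl⟩ := Matrix.torusHom_surjective hM w
  rw [← Matrix.card_ker_torusHom (K := K) hM]
  refine Nat.card_congr ((Equiv.mulRight z₀⁻¹).subtypeEquiv fun z => ?_)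
  rw [Equiv.coe_mulRight, MonoidHom.mem_ker, map_mul, map_inv, mul_inv_eq_one]

end MonomialSystem

/-! ### Counting solutions with distinct components in each block -/

section DistinctComponents

/-- The injections into a finite group that send a base point to `1`. -/
theorem card_embedding_map_eq_one {J G : Type*} [Fintype J] [Group G] [Fintype G] (b : J) :
    Nat.card {e : J ↪ G // e b = 1} =
      (Fintype.card G - 1).descFactorial (Fintype.card J - 1) := by
  classical
  -- Left translation normalizes the value at `b`, so all injections are counted `|G|` to one by the
  -- normalized ones; the factor `|G|` is then cancelled from the falling factorial.
  have e : (J ↪ G) ≃ G × {e : J ↪ G // e b = 1} :=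
    { toFun := fun f => (f b, ⟨f.trans (Equiv.mulLeft (f b)⁻¹).toEmbedding, by simp⟩)
      invFun := fun x => x.2.1.trans (Equiv.mulLeft x.1).toEmbedding
      left_inv := fun f => by ext; simp
      right_inv := fun ⟨g, f, hf⟩ => by
        refine Prod.ext (by simp [hf]) (Subtype.ext (DFunLike.ext _ _ fun j => ?_))
        simp [hf] }
  have h := Nat.card_congr e
  rw [Nat.card_prod, Nat.card_eq_fintype_card, Fintype.card_embedding_eq,
    Nat.card_eq_fintype_card] at h
  have hG : 0 < Fintype.card G := Fintype.card_pos
  have hJ : 0 < Fintype.card J := Fintype.card_pos_iff.mpr ⟨b⟩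
  obtain ⟨g, hg⟩ : ∃ g, Fintype.card G = g + 1 := ⟨_, (Nat.sub_add_cancel hG).symm⟩
  obtain ⟨j, hj⟩ : ∃ j, Fintype.card J = j + 1 := ⟨_, (Nat.sub_add_cancel hJ).symm⟩
  rw [hg, hj, Nat.succ_descFactorial_succ] at h
  rw [hg, hj]
  exact (Nat.eq_of_mul_eq_mul_left (Nat.succ_pos g) h).symm

variable {K S : Type*} [Field K] [Fintype S] [DecidableEq S] {J : S → Type*} [∀ p, Fintype (J p)]

/-- The exponents of the system satisfied by the first components of the solutions. -/
def reducedMatrix (J : S → Type*) [∀ p, Fintype (J p)] (X : S → ℕ) (C : Matrix S S ℤ) :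
    Matrix S S ℤ :=
  Matrix.of fun p q => (if p = q then (X p : ℤ) else 0) + C p q * Fintype.card (J q)

/-- The solutions `z` of `z_{p,α} ^ X_p * ∏_q (∏_β z_{q,β}) ^ C_{pq} = s_p` whose components
`z_{p,α}` with the same `p` are distinct. -/
def distinctSolutions (J : S → Type*) [∀ p, Fintype (J p)] (X : S → ℕ) (C : Matrix S S ℤ)
    (s : S → Kˣ) : Set ((Σ p, J p) → Kˣ) :=
  {z | (∀ p α, z ⟨p, α⟩ ^ X p * ∏ q, (∏ β, z ⟨q, β⟩) ^ C p q = s p) ∧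
    ∀ p, Function.Injective fun α => z ⟨p, α⟩}

/-- Writing `z = u ζ` with `ζ ^ X = 1`, the roots of unity drop out of the first factor and each
block product contributes `u_q ^ |J q|`. The resulting condition no longer involves `α`, so each
block imposes a single equation on `u`. -/
theorem mem_solutions_mul_iff {X : S → ℕ} {C : Matrix S S ℤ} {s : S → Kˣ} (u : S → Kˣ)
    (ζ : ∀ p, J p → Kˣ) (hζ : ∀ p α, ζ p α ^ X p = 1) (p : S) (α : J p) :
    (u p * ζ p α) ^ X p * ∏ q, (∏ β, u q * ζ q β) ^ C p q = s p ↔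
      (reducedMatrix J X C).torusHom K u p = s p * (∏ q, (∏ β, ζ q β) ^ C p q)⁻¹ := by
  have h : (u p * ζ p α) ^ X p * ∏ q, (∏ β, u q * ζ q β) ^ C p q =
      (reducedMatrix J X C).torusHom K u p * ∏ q, (∏ β, ζ q β) ^ C p q := by
    have h1 : (reducedMatrix J X C).torusHom K u p =
        u p ^ X p * ∏ q, (u q ^ Fintype.card (J q)) ^ C p q := by
      rw [Matrix.torusHom_apply]
      simp only [reducedMatrix, Matrix.of_apply, zpow_add, Finset.prod_mul_distrib]
      congr 1
      · rw [Finset.prod_eq_single p]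
        · simp
        · intro q _ hq
          simp [hq.symm]
        · simp
      · refine Finset.prod_congr rfl fun q _ => ?_
        rw [mul_comm, zpow_mul, zpow_natCast]
    rw [h1, mul_pow, hζ, mul_one, mul_assoc, ← Finset.prod_mul_distrib]
    congr 1
    refine Finset.prod_congr rfl fun q _ => ?_
    rw [← mul_zpow, Finset.prod_mul_distrib, Finset.prod_const, Finset.card_univ]
  rw [h, eq_mul_inv_iff_mul_eq]

variable (K) in
/-- The ratios of the components of a solution: injections into the roots of unity. -/
abbrev NormalizedRoots (X : S → ℕ) (b : ∀ p, J p) : Type _ :=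
  ∀ p, {e : J p ↪ rootsOfUnity (X p) K // e (b p) = 1}

/-- A solution is determined by its first components and the ratios to the others. -/
def distinctSolutionsEquiv (X : S → ℕ) (C : Matrix S S ℤ) (s : S → Kˣ) (b : ∀ p, J p) :
    distinctSolutions J X C s ≃
      {x : NormalizedRoots K X b × (S → Kˣ) // (reducedMatrix J X C).torusHom K x.2 =
        fun p => s p * (∏ q, (∏ β, ((x.1 q).1 β : Kˣ)) ^ C p q)⁻¹} where
  toFun z :=
    -- The equations for `α` and for `b p` share the same product over blocks and the same
    -- right-hand side, so the `X p`-th powers agree.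
    have hroot (p) (α : J p) : z.1 ⟨p, α⟩ * (z.1 ⟨p, b p⟩)⁻¹ ∈ rootsOfUnity (X p) K := by
      rw [mem_rootsOfUnity, mul_pow, inv_pow, mul_inv_eq_one]
      exact mul_right_cancel ((z.2.1 p α).trans (z.2.1 p (b p)).symm)
    ⟨(fun p => ⟨⟨fun α => ⟨z.1 ⟨p, α⟩ * (z.1 ⟨p, b p⟩)⁻¹, hroot p α⟩, fun α β h =>
        z.2.2 p (mul_right_cancel (congrArg Subtype.val h))⟩,
        Subtype.ext (mul_inv_cancel _)⟩, fun p => z.1 ⟨p, b p⟩), funext fun p =>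
      (mem_solutions_mul_iff (fun p => z.1 ⟨p, b p⟩)
        (fun p α => z.1 ⟨p, α⟩ * (z.1 ⟨p, b p⟩)⁻¹) hroot p (b p)).mp (by
          simpa using z.2.1 p (b p))⟩
  invFun x := ⟨fun i => x.1.2 i.1 * ((x.1.1 i.1).1 i.2 : Kˣ), fun p α =>
      (mem_solutions_mul_iff x.1.2 (fun p α => ((x.1.1 p).1 α : Kˣ))
        (fun p α => ((x.1.1 p).1 α).2) p α).mpr (congrFun x.2 p),
      fun p _ _ h => (x.1.1 p).1.injective (Subtype.ext (mul_left_cancel h))⟩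
  left_inv z := by
    refine Subtype.ext (funext fun i => ?_)
    change _ * (z.1 i * _⁻¹) = z.1 i
    rw [mul_comm, inv_mul_cancel_right]
  right_inv x := by
    obtain ⟨⟨e, u⟩, hx⟩ := x
    have h1 (p) : ((e p).1 (b p) : Kˣ) = 1 := congrArg Subtype.val (e p).2
    refine Subtype.ext (Prod.ext (funext fun p => Subtype.ext (DFunLike.ext _ _ fun α =>
      Subtype.ext ?_)) (funext fun p => ?_))
    · simp [h1]
    · simp [h1]

/-- The choice of ratios alters only the right-hand side of the system for the first components,
hence not its number of solutions: all fibres over the ratios have the same size `|det|`. -/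
theorem natCard_distinctSolutions [IsAlgClosed K] [CharZero K] {X : S → ℕ} (hX : ∀ p, 0 < X p)
    {C : Matrix S S ℤ} (hdet : (reducedMatrix J X C).det ≠ 0) (s : S → Kˣ) (b : ∀ p, J p) :
    Finite (distinctSolutions J X C s) ∧ Nat.card (distinctSolutions J X C s) =
      (reducedMatrix J X C).det.natAbs *
        ∏ p, (X p - 1).descFactorial (Fintype.card (J p) - 1) := by
  have hne (p) : NeZero (X p) := ⟨(hX p).ne'⟩
  have hfin (w : S → Kˣ) : Finite {u // (reducedMatrix J X C).torusHom K u = w} :=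
    Nat.finite_of_card_ne_zero (by
      rw [Matrix.card_torusHom_eq hdet]; exact Int.natAbs_ne_zero.mpr hdet)
  have hroots (p) : Nat.card {e : J p ↪ rootsOfUnity (X p) K // e (b p) = 1} =
      (X p - 1).descFactorial (Fintype.card (J p) - 1) := by
    have := Fintype.ofFinite (rootsOfUnity (X p) K)
    rw [card_embedding_map_eq_one, ← Nat.card_eq_fintype_card,
      HasEnoughRootsOfUnity.natCard_rootsOfUnity]
  have hfr (p) : Finite {e : J p ↪ rootsOfUnity (X p) K // e (b p) = 1} := inferInstance
  let E := (distinctSolutionsEquiv X C s b).trans (Equiv.subtypeProdEquivSigmaSubtype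
    fun (e : NormalizedRoots K X b) (u : S → Kˣ) => (reducedMatrix J X C).torusHom K u =
        fun p => s p * (∏ q, (∏ β, ((e q).1 β : Kˣ)) ^ C p q)⁻¹)
  have : Fintype (NormalizedRoots K X b) := Fintype.ofFinite _
  refine ⟨Finite.of_equiv _ E.symm, ?_⟩
  rw [Nat.card_congr E, Nat.card_sigma]
  simp only [Matrix.card_torusHom_eq hdet]
  rw [Finset.sum_const, Finset.card_univ, smul_eq_mul, mul_comm, ← Nat.card_eq_fintype_card,
    Nat.card_pi]
  simp only [hroots]

end DistinctComponents

/-! ### Positive definite quadratic forms -/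

section Definiteness

variable {n : Type*} [Fintype n]

/-- A symmetric matrix with non-positive off-diagonal entries that maps some positive vector to a
positive vector has a positive definite quadratic form. -/
theorem sum_mul_mul_pos_of_offDiag_nonpos {S : n → n → ℝ} {v : n → ℝ}
    (hsymm : ∀ a b, S a b = S b a) (hoff : ∀ a b, a ≠ b → S a b ≤ 0) (hv : ∀ a, 0 < v a)
    (hSv : ∀ a, 0 < ∑ b, S a b * v b) {x : n → ℝ} (hx : x ≠ 0) :
    0 < ∑ a, ∑ b, x a * S a b * x b := by
  set y : n → ℝ := fun a => x a / v a with hy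
  have hxy : ∀ a, x a = y a * v a := fun a => (div_mul_cancel₀ _ (hv a).ne').symm
  have id1 : ∑ a, ∑ b, S a b * v a * v b * (y a ^ 2 - y b ^ 2) = 0 := by
    have h := Finset.sum_comm (s := Finset.univ) (t := Finset.univ)
      (f := fun a b => S a b * v a * v b * (y a ^ 2 - y b ^ 2))
    have h2 : ∑ b, ∑ a, S a b * v a * v b * (y a ^ 2 - y b ^ 2) =
        -∑ a, ∑ b, S a b * v a * v b * (y a ^ 2 - y b ^ 2) := by
      simp only [← Finset.sum_neg_distrib]
      refine Finset.sum_congr rfl fun a _ => Finset.sum_congr rfl fun b _ => ?_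
      rw [hsymm b a]; ring
    linarith
  -- This is `y_a y_b = y_a² - (y_a - y_b)² / 2 - (y_a² - y_b²) / 2`, weighted by `S a b * v a * v
  -- b`. The last term is antisymmetric in `a, b` and sums to zero by `id1`; the other two are
  -- non-negative by the hypotheses on `S v` and on the off-diagonal signs.
  have id2 : ∑ a, ∑ b, x a * S a b * x b =
      ∑ a, v a * y a ^ 2 * (∑ b, S a b * v b)
        + ∑ a, ∑ b, -S a b * v a * v b * (y a - y b) ^ 2 / 2
        - (∑ a, ∑ b, S a b * v a * v b * (y a ^ 2 - y b ^ 2)) / 2 := by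
    simp only [Finset.mul_sum, Finset.sum_div, ← Finset.sum_add_distrib, ← Finset.sum_sub_distrib]
    refine Finset.sum_congr rfl fun a _ => Finset.sum_congr rfl fun b _ => ?_
    rw [hxy a, hxy b]; ring
  rw [id2, id1, zero_div, sub_zero]
  refine add_pos_of_pos_of_nonneg ?_ ?_
  · obtain ⟨a, ha⟩ := Function.ne_iff.mp hx
    refine Finset.sum_pos' (fun a _ => mul_nonneg (mul_nonneg (hv a).le (sq_nonneg _)) (hSv a).le)
      ⟨a, Finset.mem_univ _, mul_pos (mul_pos (hv a) (sq_pos_of_ne_zero (div_ne_zero ha (hv a).ne'))) (hSv a)⟩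
  · refine Finset.sum_nonneg fun a _ => Finset.sum_nonneg fun b _ => ?_
    by_cases h : a = b
    · simp [h]
    · have := hoff a b h
      have := hv a
      have := hv b
      have : 0 ≤ -S a b := by linarith
      positivity

/-- The minimum counts the levels `k ≥ 1` lying below both numbers. This exhibits the kernel `min`
as a sum of rank-one kernels. -/
theorem natCast_min_eq_sum {M x y : ℕ} (hx : x ≤ M) :
    ((min x y : ℕ) : ℝ) =
      ∑ k ∈ Finset.Icc 1 M, (if k ≤ x then (1 : ℝ) else 0) * (if k ≤ y then 1 else 0) := by
  simp only [← ite_and, mul_ite, mul_one, mul_zero, ← le_min_iff]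
  rw [Finset.sum_ite, Finset.sum_const_zero, add_zero, Finset.sum_const, nsmul_eq_mul, mul_one]
  congr 1
  have : Finset.filter (fun k => k ≤ min x y) (Finset.Icc 1 M) = Finset.Icc 1 (min x y) := by
    ext k; simp only [Finset.mem_filter, Finset.mem_Icc]; omega
  simp_all [and_comm]

/-- If `S` is positive definite and `p ↦ (a p, h p)` is injective with `h p > 0`, then
`S (a p) (a q) * min (h p) (h q)` is positive definite. -/
theorem sum_mul_min_mul_pos {H : Type*} [Fintype H] {S : n → n → ℝ}
    (hS : ∀ x : n → ℝ, x ≠ 0 → 0 < ∑ a, ∑ b, x a * S a b * x b)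
    {a : H → n} {h : H → ℕ} (hpos : ∀ p, 0 < h p)
    (hinj : ∀ p q, a p = a q → h p = h q → p = q) {y : H → ℝ} (hy : y ≠ 0) :
    0 < ∑ p, ∑ q, y p * (S (a p) (a q) * (min (h p) (h q) : ℕ)) * y q := by
  classical
  -- Any common upper bound for the heights would do.
  set M := ∑ p, h p with hM
  have hle : ∀ p, h p ≤ M := fun p => Finset.single_le_sum (fun _ _ => Nat.zero_le _)
    (Finset.mem_univ p)
  -- The slice of `y` at level `k`: the total of `y p` over the `p` above `c` of height at least
  -- `k`. The form to be bounded is the sum over `k` of the `S`-forms of these slices.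
  let Y (k : ℕ) (c : n) : ℝ := ∑ p, if a p = c then y p * (if k ≤ h p then 1 else 0) else 0
  have hquad (k : ℕ) : ∑ c, ∑ d, Y k c * S c d * Y k d =
      ∑ p, ∑ q, y p * (S (a p) (a q) *
        ((if k ≤ h p then 1 else 0) * (if k ≤ h q then 1 else 0))) * y q := by
    have e1 : ∀ c d, Y k c * S c d * Y k d = ∑ p, ∑ q,
        (if a p = c then if a q = d then y p * (S c d *
        ((if k ≤ h p then 1 else 0) * (if k ≤ h q then 1 else 0))) * y q else 0 else 0) := by
      intro c d
      simp only [Y, Finset.sum_mul, Finset.mul_sum]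
      rw [Finset.sum_comm]
      refine Finset.sum_congr rfl fun p _ => Finset.sum_congr rfl fun q _ => ?_
      by_cases h1 : a p = c <;> by_cases h2 : a q = d <;> simp [h1, h2]
    simp only [e1]
    have e2 : ∀ c, ∑ d, ∑ p, ∑ q,
        (if a p = c then if a q = d then y p * (S c d *
        ((if k ≤ h p then 1 else 0) * (if k ≤ h q then 1 else 0))) * y q else 0 else 0) =
        ∑ p, if a p = c then ∑ q, y p * (S c (a q) *
        ((if k ≤ h p then 1 else 0) * (if k ≤ h q then 1 else 0))) * y q else 0 := by
      intro c
      rw [Finset.sum_comm]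
      refine Finset.sum_congr rfl fun p _ => ?_
      by_cases h1 : a p = c
      · simp only [h1, if_true]
        rw [Finset.sum_comm]
        exact Finset.sum_congr rfl fun q _ => by rw [Finset.sum_ite_eq]; simp
      · simp [h1]
    simp only [e2]
    rw [Finset.sum_comm]
    exact Finset.sum_congr rfl fun p _ => by rw [Finset.sum_ite_eq]; simp
  have key : ∑ p, ∑ q, y p * (S (a p) (a q) * (min (h p) (h q) : ℕ)) * y q =
      ∑ k ∈ Finset.Icc 1 M, ∑ c, ∑ d, Y k c * S c d * Y k d := by
    simp only [hquad]
    rw [Finset.sum_comm (s := Finset.Icc 1 M)]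
    refine Finset.sum_congr rfl fun p _ => ?_
    rw [Finset.sum_comm]
    refine Finset.sum_congr rfl fun q _ => ?_
    rw [natCast_min_eq_sum (hle p)]
    simp only [Finset.mul_sum, Finset.sum_mul]
  have hnn (k : ℕ) : 0 ≤ ∑ c, ∑ d, Y k c * S c d * Y k d := by
    by_cases h0 : Y k = 0
    · simp [h0]
    · exact (hS _ h0).le
  rw [key]
  refine (Finset.sum_nonneg fun k _ => hnn k).lt_of_ne' fun h0 => hy ?_
  rw [Finset.sum_eq_zero_iff_of_nonneg fun k _ => hnn k] at h0
  have hY : ∀ k, 1 ≤ k → Y k = 0 := by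
    intro k hk
    by_cases hkM : k ≤ M
    · by_contra hne
      exact (hS _ hne).ne' (h0 k (Finset.mem_Icc.mpr ⟨hk, hkM⟩))
    · funext c
      refine Finset.sum_eq_zero fun p _ => ?_
      have : ¬ k ≤ h p := fun hh => hkM (hh.trans (hle p))
      simp [this]
  funext p
  have h1 := congrFun (hY (h p) (hpos p)) (a p)
  have h2 := congrFun (hY (h p + 1) (Nat.succ_pos _)) (a p)
  -- Consecutive slices differ by the entries of height exactly `h p` above `a p`, and by
  -- injectivity `p` is the only such index. So if all slices vanish, `y` vanishes.
  have h3 : Y (h p) (a p) - Y (h p + 1) (a p) = y p := by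
    simp only [Y, ← Finset.sum_sub_distrib]
    rw [Finset.sum_eq_single p]
    · simp
    · intro q _ hq
      by_cases ha : a q = a p
      · have : h q ≠ h p := fun e => hq (hinj q p ha e)
        simp only [ha, if_true]
        by_cases hlt : h p ≤ h q
        · have : h p + 1 ≤ h q := by omega
          simp [hlt, this]
        · have : ¬ h p + 1 ≤ h q := by omega
          simp [hlt, this]
      · simp [ha]
    · simp
  simpa [h1, h2] using h3.symm

end Definiteness

/-! ### Positive vectors for the classical Cartan matrices -/

section Cartan

open CartanMatrix

theorem Fin.sum_ite_val_eq {n : ℕ} (k : ℕ) (e : ℤ) :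
    ∑ b : Fin n, (if b.val = k then e else 0) = if k < n then e else 0 := by
  rw [Fin.sum_univ_eq_sum_range (fun i => if i = k then e else 0), Finset.sum_ite_eq']
  simp

theorem Fin.sum_ite_val_add_eq {n : ℕ} (j k : ℕ) (e : ℤ) :
    ∑ b : Fin n, (if b.val + j = k then e else 0) = if j ≤ k ∧ k < n + j then e else 0 := by
  by_cases h : j ≤ k
  · rw [← Nat.sub_add_cancel h]
    simp only [Nat.add_right_cancel_iff, Fin.sum_ite_val_eq]
    congr 1
    simp
  · rw [if_neg (fun h' => h h'.1)]
    exact Finset.sum_eq_zero fun b _ => if_neg (by omega)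

/-- The vector is `i (n + 1 - i)` with `i = b + 1`, the coefficients of the sum of the positive
roots. It vanishes at `i = 0` and `i = n + 1`, and minus its second difference is `2`, so `A n` maps
it to the constant vector `2`. -/
theorem CartanMatrix.A_mulVec_pos (n : ℕ) (a : Fin n) :
    0 < ∑ b, A n a b * (((b.val : ℤ) + 1) * (n - b.val)) := by
  have h : ∀ b : Fin n, A n a b * (((b.val : ℤ) + 1) * (n - b.val)) =
      (if b.val = a.val then 2 * (((a.val : ℤ) + 1) * (n - a.val)) else 0)
      + (if b.val = a.val + 1 then -(((a.val : ℤ) + 2) * (n - a.val - 1)) else 0)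
      + (if b.val + 1 = a.val then -((a.val : ℤ) * (n - a.val + 1)) else 0) := by
    intro b
    simp only [A, Matrix.of_apply, Fin.ext_iff]
    generalize a.val = a, b.val = b
    rcases (by omega : b = a ∨ b = a + 1 ∨ a = b + 1 ∨ (b ≠ a ∧ b ≠ a + 1 ∧ a ≠ b + 1)) with
      rfl | rfl | rfl | h <;> split_ifs <;> first | omega | (push_cast; ring)
  simp only [h, Finset.sum_add_distrib, Fin.sum_ite_val_eq, Fin.sum_ite_val_add_eq]
  have ha := a.isLt
  generalize a.val = a at ha
  split_ifs
  all_goals first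
    | omega
    | (ring_nf; norm_num; done)
    | (obtain rfl : a = 0 := by omega
       push_cast; ring_nf; norm_num; done)
    | (obtain rfl : n = a + 1 := by omega
       push_cast; ring_nf; norm_num; done)
    | (obtain rfl : a = 0 := by omega
       obtain rfl : n = 1 := by omega
       norm_num)

/-- The vector `i (2 n - i)`, `i = b + 1`, is mapped to the constant vector `2`; in the last row
this reads `2 n² - 2 (n² - 1) = 2`. -/
theorem CartanMatrix.C_mulVec_pos (n : ℕ) (a : Fin n) :
    0 < ∑ b, C n a b * (((b.val : ℤ) + 1) * (2 * n - 1 - b.val)) := by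
  have ha := a.isLt
  have h : ∀ b : Fin n, C n a b * (((b.val : ℤ) + 1) * (2 * n - 1 - b.val)) =
      (if b.val = a.val then 2 * (((a.val : ℤ) + 1) * (2 * n - 1 - a.val)) else 0)
      + (if b.val = a.val + 1 then -(((a.val : ℤ) + 2) * (2 * n - a.val - 2)) else 0)
      + (if b.val + 1 = a.val then (if a.val = n - 1 then -2 else -1) *
          ((a.val : ℤ) * (2 * n - a.val)) else 0) := by
    intro b
    simp only [C, Matrix.of_apply, Fin.ext_iff]
    generalize a.val = a, b.val = b
    rcases (by omega : b = a ∨ b = a + 1 ∨ a = b + 1 ∨ (b ≠ a ∧ b ≠ a + 1 ∧ a ≠ b + 1)) with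
      rfl | rfl | rfl | h <;> split_ifs <;> first | omega | (push_cast; ring)
  simp only [h, Finset.sum_add_distrib, Fin.sum_ite_val_eq, Fin.sum_ite_val_add_eq]
  generalize a.val = a at ha
  split_ifs
  all_goals first
    | omega
    | (ring_nf; norm_num; done)
    | (obtain rfl : a = 0 := by omega
       push_cast; ring_nf; norm_num; done)
    | (obtain rfl : n = a + 1 := by omega
       push_cast; ring_nf; norm_num; done)
    | (obtain rfl : a = 0 := by omega
       obtain rfl : n = 1 := by omega
       norm_num)

/-- Conjugation by `diag(1, …, 1, 2)` relates `B n` to `C n`. The vector is accordingly twice the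
one used for `C n`, with its last entry halved; its image is `4` everywhere except for a final `2`.
-/
theorem CartanMatrix.B_mulVec_pos (n : ℕ) (a : Fin n) :
    0 < ∑ b, B n a b * (if b.val + 1 = n then (n : ℤ) * n
      else 2 * (((b.val : ℤ) + 1) * (2 * n - 1 - b.val))) := by
  have ha := a.isLt
  have h : ∀ b : Fin n, B n a b * (if b.val + 1 = n then (n : ℤ) * n
      else 2 * (((b.val : ℤ) + 1) * (2 * n - 1 - b.val))) =
      (if b.val = a.val then 2 * (if a.val + 1 = n then (n : ℤ) * n
        else 2 * (((a.val : ℤ) + 1) * (2 * n - 1 - a.val))) else 0)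
      + (if b.val = a.val + 1 then -(2 * (((a.val : ℤ) + 2) * (2 * n - a.val - 2))) else 0)
      + (if b.val + 1 = a.val then -(2 * ((a.val : ℤ) * (2 * n - a.val))) else 0) := by
    intro b
    have hb := b.isLt
    simp only [B, Matrix.of_apply, Fin.ext_iff]
    generalize a.val = a at ha
    generalize b.val = b at hb
    rcases (by omega : b = a ∨ b = a + 1 ∨ a = b + 1 ∨ (b ≠ a ∧ b ≠ a + 1 ∧ a ≠ b + 1)) with
      rfl | rfl | rfl | h <;> split_ifs <;> first
        | omega
        | (push_cast; ring; done)
        | (obtain rfl : n = a + 2 := by omega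
           push_cast; ring)
  simp only [h, Finset.sum_add_distrib, Fin.sum_ite_val_eq, Fin.sum_ite_val_add_eq]
  generalize a.val = a at ha
  split_ifs
  all_goals first
    | omega
    | (ring_nf; norm_num; done)
    | (obtain rfl : a = 0 := by omega
       push_cast; ring_nf; norm_num; done)
    | (obtain rfl : n = a + 1 := by omega
       push_cast; ring_nf; norm_num; done)
    | (obtain rfl : a = 0 := by omega
       obtain rfl : n = 1 := by omega
       norm_num)

/-- With `i = b + 1` the entries are `2 i (2 n - 1 - i)` along the chain and `n (n - 1)` at the two
end nodes of the fork: twice the sum of the positive roots, mapped to the constant vector `4`. -/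
theorem CartanMatrix.D_mulVec_pos (n : ℕ) (hn : 3 ≤ n) (a : Fin n) :
    0 < ∑ b, D n a b * (if b.val + 2 < n then 2 * (((b.val : ℤ) + 1) * (2 * n - 2 - b.val))
      else (n : ℤ) * (n - 1)) := by
  have ha := a.isLt
  have h : ∀ b : Fin n, D n a b *
      (if b.val + 2 < n then 2 * (((b.val : ℤ) + 1) * (2 * n - 2 - b.val))
      else (n : ℤ) * (n - 1)) =
      (if b.val = a.val then 2 *
        (if a.val + 2 < n then 2 * (((a.val : ℤ) + 1) * (2 * n - 2 - a.val))
          else (n : ℤ) * (n - 1)) else 0)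
      + (if b.val = a.val + 1 then
          if a.val + 3 < n then -(2 * (((a.val : ℤ) + 2) * (2 * n - 3 - a.val)))
            else if a.val + 3 = n then -((n : ℤ) * (n - 1)) else 0 else 0)
      + (if b.val = a.val + 2 then if a.val + 3 = n then -((n : ℤ) * (n - 1)) else 0 else 0)
      + (if b.val + 1 = a.val then
          if a.val + 1 < n then -(2 * ((a.val : ℤ) * (2 * n - 1 - a.val))) else 0 else 0)
      + (if b.val + 2 = a.val then
          if a.val + 1 = n then -(2 * ((a.val - 1 : ℤ) * (2 * n - a.val))) else 0 else 0) := by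
    intro b
    have hb := b.isLt
    simp only [D, Matrix.of_apply, Fin.ext_iff]
    generalize a.val = a at ha
    generalize b.val = b at hb
    clear * - ha hb hn
    rcases (by omega : a + 3 < n ∨ n = a + 3 ∨ n = a + 2 ∨ n = a + 1) with h1 | h1 | h1 | h1
    all_goals
      rcases (by omega : b = a ∨ b = a + 1 ∨ b = a + 2 ∨ a = b + 1 ∨ a = b + 2 ∨
        (b ≠ a ∧ b ≠ a + 1 ∧ b ≠ a + 2 ∧ a ≠ b + 1 ∧ a ≠ b + 2)) with
        rfl | rfl | rfl | rfl | rfl | h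
    all_goals first
      | omega
      | (simp (disch := omega) only [if_pos, if_neg, true_and]
         try (push_cast; ring))
  rw [Finset.sum_congr rfl fun b _ => h b]
  simp only [Finset.sum_add_distrib]
  rw [Fin.sum_ite_val_eq, Fin.sum_ite_val_eq, Fin.sum_ite_val_eq, Fin.sum_ite_val_add_eq,
    Fin.sum_ite_val_add_eq]
  clear h
  generalize a.val = a at ha
  rcases (by omega : a + 3 < n ∨ n = a + 3 ∨ n = a + 2 ∨ n = a + 1) with h1 | h1 | h1 | h1
  all_goals
    rcases (by omega : a = 0 ∨ 1 ≤ a) with h2 | h2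
  all_goals first
    | omega
    | (simp (disch := omega) only [if_pos, if_neg, ite_self]
       try subst h1
       try subst h2
       push_cast
       try (ring_nf; norm_num))

end Cartan

/-! ### Positive definiteness for all finite types -/

section FiniteType

open CartanMatrix

/-- A symmetrizable integer matrix with non-positive off-diagonal entries that maps some positive
vector to a positive vector. -/
def Matrix.IsFiniteCartan {n : ℕ} (A : Matrix (Fin n) (Fin n) ℤ) : Prop :=
  ∃ g v : Fin n → ℤ, (∀ a, 0 < g a) ∧ (∀ a, 0 < v a) ∧ (∀ a b, g a * A a b = g b * A b a) ∧
    (∀ a b, a ≠ b → A a b ≤ 0) ∧ ∀ a, 0 < ∑ b, A a b * v b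

theorem CartanMatrix.A_isFiniteCartan (n : ℕ) : (A n).IsFiniteCartan :=
  ⟨fun _ => 1, fun b => ((b.val : ℤ) + 1) * (n - b.val), fun _ => one_pos,
    fun b => mul_pos (by omega) (by omega), fun a b => by rw [(A_isSymm n).apply],
    A_apply_le_zero_of_ne n, A_mulVec_pos n⟩

theorem CartanMatrix.B_isFiniteCartan (n : ℕ) : (B n).IsFiniteCartan := by
  refine ⟨fun a => if a.val = n - 1 then 2 else 1, _, fun a => ?_, fun b => ?_, fun a b => ?_,
    B_off_diag_nonpos n, B_mulVec_pos n⟩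
  · dsimp only; split_ifs <;> norm_num
  · have := b.isLt
    split_ifs
    · exact mul_pos (by omega) (by omega)
    · exact mul_pos two_pos (mul_pos (by omega) (by omega))
  · simp only [B, Matrix.of_apply]
    grind

theorem CartanMatrix.C_isFiniteCartan (n : ℕ) : (C n).IsFiniteCartan := by
  refine ⟨fun a => if a.val = n - 1 then 1 else 2, _, fun a => ?_, fun b => ?_, fun a b => ?_,
    C_off_diag_nonpos n, C_mulVec_pos n⟩
  · dsimp only; split_ifs <;> norm_num
  · have := b.isLt
    exact mul_pos (by omega) (by omega)
  · simp only [C, Matrix.of_apply]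
    grind

theorem CartanMatrix.B_transpose_isFiniteCartan (n : ℕ) : (B n)ᵀ.IsFiniteCartan := by
  rw [B_transpose]
  exact C_isFiniteCartan n

theorem CartanMatrix.C_transpose_isFiniteCartan (n : ℕ) : (C n)ᵀ.IsFiniteCartan := by
  rw [C_transpose]
  exact B_isFiniteCartan n

theorem CartanMatrix.D_isFiniteCartan {n : ℕ} (hn : 3 ≤ n) : (D n).IsFiniteCartan := by
  refine ⟨fun _ => 1, _, fun _ => one_pos, fun b => ?_, fun a b => by rw [(D_isSymm n).apply],
    D_off_diag_nonpos n, D_mulVec_pos n hn⟩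
  have := b.isLt
  split_ifs
  · exact mul_pos two_pos (mul_pos (by omega) (by omega))
  · exact mul_pos (by omega) (by omega)

/-- In this and the other exceptional cases the second witness is the solution `v` of `A v = (2, …,
2)`; for the simply laced types it lists the coefficients of the sum of the positive roots. -/
theorem SCE.cartanE6_isFiniteCartan : SCE.cartanE6.IsFiniteCartan :=
  ⟨fun _ => 1, ![16, 30, 42, 22, 30, 16], by decide, by decide, by decide,
    fun a b h => neg_nonneg.mp
      (((by decide : ∀ a b, a = b ∨ 0 ≤ -SCE.cartanE6 a b) a b).resolve_left h), by decide⟩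

theorem SCE.cartanE7_isFiniteCartan : SCE.cartanE7.IsFiniteCartan :=
  ⟨fun _ => 1, ![34, 66, 96, 75, 52, 27, 49], by decide, by decide, by decide,
    fun a b h => neg_nonneg.mp
      (((by decide : ∀ a b, a = b ∨ 0 ≤ -SCE.cartanE7 a b) a b).resolve_left h), by decide⟩

theorem SCE.cartanE8_isFiniteCartan : SCE.cartanE8.IsFiniteCartan :=
  ⟨fun _ => 1, ![58, 114, 168, 220, 270, 182, 92, 136], by decide, by decide, by decide,
    fun a b h => neg_nonneg.mp
      (((by decide : ∀ a b, a = b ∨ 0 ≤ -SCE.cartanE8 a b) a b).resolve_left h), by decide⟩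

theorem CartanMatrix.F₄_isFiniteCartan : F₄.IsFiniteCartan :=
  ⟨![1, 1, 2, 2], ![22, 42, 30, 16], by decide, by decide, by decide,
    F₄_off_diag_nonpos, by decide⟩

theorem CartanMatrix.F₄_transpose_isFiniteCartan : F₄ᵀ.IsFiniteCartan :=
  ⟨![2, 2, 1, 1], ![16, 30, 42, 22], by decide, by decide, by decide,
    fun a b h => F₄_off_diag_nonpos b a h.symm, by decide⟩

theorem CartanMatrix.G₂_isFiniteCartan : G₂.IsFiniteCartan :=
  ⟨![1, 3], ![10, 6], by decide, by decide, by decide,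
    G₂_off_diag_nonpos, by decide⟩

theorem CartanMatrix.G₂_transpose_isFiniteCartan : G₂ᵀ.IsFiniteCartan :=
  ⟨![3, 1], ![6, 10], by decide, by decide, by decide,
    fun a b h => G₂_off_diag_nonpos b a h.symm, by decide⟩

theorem SCE.AffineType.cartan_isFiniteCartan (t : SCE.AffineType) : t.cartan.IsFiniteCartan := by
  cases t with
  | A1 n _ => exact A_isFiniteCartan n
  | B1 n _ => exact B_transpose_isFiniteCartan n
  | C1 n _ => exact C_transpose_isFiniteCartan n
  | D1 n h => exact D_isFiniteCartan (n := n) (by omega)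
  | E61 => exact cartanE6_isFiniteCartan
  | E71 => exact cartanE7_isFiniteCartan
  | E81 => exact cartanE8_isFiniteCartan
  | F41 => exact F₄_transpose_isFiniteCartan
  | G21 => exact G₂_transpose_isFiniteCartan
  | A2even n _ => exact B_transpose_isFiniteCartan n
  | A2odd n _ => exact C_transpose_isFiniteCartan n
  | D2 n _ => exact B_transpose_isFiniteCartan n
  | E62 => exact F₄_isFiniteCartan
  | D43 => exact G₂_isFiniteCartan

theorem Matrix.IsFiniteCartan.exists_symmetrizer {n : ℕ} {A : Matrix (Fin n) (Fin n) ℤ}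
    (hA : A.IsFiniteCartan) : ∃ g : Fin n → ℤ, (∀ a, 0 < g a) ∧
      (∀ a b, g a * A a b = g b * A b a) ∧ ∀ x : Fin n → ℝ, x ≠ 0 →
        0 < ∑ a, ∑ b, x a * ((g a * A a b : ℤ) : ℝ) * x b := by
  obtain ⟨g, v, hg, hv, hsymm, hoff, hpos⟩ := hA
  refine ⟨g, hg, hsymm, fun x hx => ?_⟩
  refine sum_mul_mul_pos_of_offDiag_nonpos (S := fun a b => ((g a * A a b : ℤ) : ℝ))
    (v := fun a => (v a : ℝ)) (fun a b => by rw [hsymm])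
    (fun a b hab => ?_) (fun a => by exact_mod_cast hv a) (fun a => ?_) hx
  · exact_mod_cast mul_nonpos_of_nonneg_of_nonpos (hg a).le (hoff a b hab)
  · have h := mul_pos (hg a) (hpos a)
    rw [Finset.mul_sum] at h
    simp only [← mul_assoc] at h
    exact_mod_cast h

end FiniteType

/-! ### The determinant of `F` and the reduction of the string center equation -/

namespace SCE

open AffineType

variable {t : AffineType}

theorem AffineType.coef_mul (p q : t.H) :
    t.coef p q * (t.eps p.1 * t.d q.1) = t.cartan p.1 q.1 * t.minD p q :=
  Int.ediv_mul_cancel (t.eps_mul_d_dvd_cartan_mul p q)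

theorem AffineType.minD_eq (p q : t.H) :
    t.minD p q = ((min (t.d q.1 * q.2) (t.d p.1 * p.2) : ℕ) : ℤ) := by
  simp [minD, min_comm]

/-- Rescaling rows and columns turns `F` into the sum of a non-negative diagonal matrix and a
positive definite one. -/
theorem det_F_pos {ν N : t.Pattern} (hP : ∀ p ∈ N.support, 0 ≤ P ν N p) : 0 < (F ν N).det := by
  obtain ⟨g, hg, hsymm, hdef⟩ := t.cartan_isFiniteCartan.exists_symmetrizer
  have hN (p : N.support) : (0 : ℝ) < N p :=
    Nat.cast_pos.mpr (Nat.pos_of_ne_zero (Finsupp.mem_support_iff.mp p.2))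
  have hd (p : N.support) : (0 : ℝ) < t.d p.1.1 := Nat.cast_pos.mpr (t.d_pos _)
  have he (p : N.support) : (0 : ℝ) < g p.1.1 * t.eps p.1.1 :=
    mul_pos (by exact_mod_cast hg _) (Nat.cast_pos.mpr (t.eps_pos _))
  -- The row factor `d'_a` clears one denominator of `F`; the column factor cancels `N_q` and `ε_b`
  -- and inserts the symmetrizer `g_b`. What is left off the diagonal is `g_b A_{ba} min(d'_a m,
  -- d'_b k)`, which is symmetric.
  set r : N.support → ℝ := fun p => t.d p.1.1 with hr
  set c : N.support → ℝ := fun p => g p.1.1 * t.eps p.1.1 / N p with hc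
  have hcpos (p) : 0 < c p := div_pos (he p) (hN p)
  set G : Matrix N.support N.support ℝ :=
    Matrix.diagonal r * (F ν N).map (Int.cast : ℤ → ℝ) * Matrix.diagonal c with hG
  set h : N.support → ℕ := fun p => t.d p.1.1 * p.1.2 with hh
  set S : Fin t.rank → Fin t.rank → ℝ := fun a b => ((g a * t.cartan a b : ℤ) : ℝ) with hS
  have hGapp (p q) : G p q = (if p = q then r p * P ν N p * c p else 0) +
      S p.1.1 q.1.1 * (min (h p) (h q) : ℕ) := by
    have hcoef := congrArg (Int.cast : ℤ → ℝ) (t.coef_mul q.1 p.1)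
    rw [t.minD_eq] at hcoef
    push_cast at hcoef
    have hSs : S p.1.1 q.1.1 = g q.1.1 * t.cartan q.1.1 p.1.1 := by
      simp only [hS, hsymm p.1.1 q.1.1]; push_cast; rfl
    have h2 : r p * (t.coef q p * N q) * c q = S p.1.1 q.1.1 * (min (h p) (h q) : ℕ) := by
      have : (N q : ℝ) * c q = g q.1.1 * t.eps q.1.1 := mul_div_cancel₀ _ (hN q).ne'
      calc r p * (t.coef q p * N q) * c q
          = r p * t.coef q p * (N q * c q) := by ring
        _ = g q.1.1 * (t.coef q p * (t.eps q.1.1 * t.d p.1.1)) := by rw [this]; ring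
        _ = _ := by rw [hcoef, hSs]; simp only [hh]; push_cast; ring
    rw [← h2, hG, Matrix.mul_diagonal, Matrix.diagonal_mul, Matrix.map_apply, F, Matrix.of_apply]
    by_cases hpq : p = q
    · subst hpq
      simp only [if_true]
      push_cast
      ring
    · simp only [hpq, if_false, zero_add]
      push_cast
      ring
  have hpd : G.PosDef := by
    refine Matrix.PosDef.of_dotProduct_mulVec_pos ?_ fun x hx => ?_
    · ext p q
      rw [Matrix.conjTranspose_apply, star_trivial, hGapp, hGapp, min_comm]
      congr 1
      · by_cases hpq : p = q
        · subst hpq; rfl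
        · simp [hpq, Ne.symm hpq]
      · simp only [hS, hsymm p.1.1 q.1.1]
    · have hsum : star x ⬝ᵥ (G *ᵥ x) = ∑ p, r p * P ν N p * c p * x p ^ 2 +
          ∑ p, ∑ q, x p * (S p.1.1 q.1.1 * (min (h p) (h q) : ℕ)) * x q := by
        simp only [dotProduct, Matrix.mulVec, hGapp, star_trivial, Pi.star_apply]
        rw [← Finset.sum_add_distrib]
        refine Finset.sum_congr rfl fun p _ => ?_
        simp only [add_mul, Finset.sum_add_distrib, ite_mul, zero_mul, Finset.sum_ite_eq,
          Finset.mem_univ, if_true, mul_add, Finset.mul_sum]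
        congr 1
        · ring
        · exact Finset.sum_congr rfl fun q _ => by ring
      rw [hsum]
      refine add_pos_of_nonneg_of_pos (Finset.sum_nonneg fun p _ => ?_)
        (sum_mul_min_mul_pos (a := fun p : N.support => p.1.1) hdef
          (fun p => Nat.mul_pos (t.d_pos _) p.1.2.pos) (fun p q hpq h' => ?_) hx)
      · have : (0 : ℝ) ≤ P ν N p := by exact_mod_cast hP p p.2
        exact mul_nonneg (mul_nonneg (mul_nonneg (hd p).le this) (hcpos p).le) (sq_nonneg _)
      -- For equal `a`, the heights `d'_a m` and `d'_a k` agree only if `m = k`, since `d'_a > 0`.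
      · refine Subtype.ext (Prod.ext hpq (PNat.coe_injective ?_))
        simp only [hpq] at h'
        exact Nat.eq_of_mul_eq_mul_left (t.d_pos _) h'
  have hdet := hpd.det_pos
  rw [hG, Matrix.det_mul, Matrix.det_mul, Matrix.det_diagonal, Matrix.det_diagonal] at hdet
  have h1 := pos_of_mul_pos_left hdet (Finset.prod_nonneg fun p _ => (hcpos p).le)
  have h2 := pos_of_mul_pos_right h1 (Finset.prod_nonneg fun p _ => (hd p).le)
  have h3 : ((F ν N).map (Int.cast : ℤ → ℝ)).det = ((F ν N).det : ℝ) :=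
    (RingHom.map_det (Int.castRingHom ℝ) (F ν N)).symm
  rw [h3] at h2
  exact_mod_cast h2

/-- The exponents of the products `∏_β z_{q,β}` in the string center equation. -/
def blockExpo (N : t.Pattern) : Matrix N.support N.support ℤ :=
  Matrix.of fun p q => t.coef q p - if p = q then 1 else 0

/-- Off the term `i = j`, the exponent depends only on the blocks of `i` and `j`, so the factors
from one block combine into a power of the block product. -/
theorem prod_zpow_expo {ν N : t.Pattern} (z : Idx N → ℂˣ) (i : Idx N) :
    ∏ j, z j ^ expo ν N i j =
      z i ^ (P ν N i.1 + N i.1) * ∏ q, (∏ β, z ⟨q, β⟩) ^ blockExpo N i.1 q := by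
  have h (j) : z j ^ expo ν N i j =
      z j ^ (if i = j then P ν N i.1 + N i.1 else 0) * z j ^ blockExpo N i.1 j.1 := by
    rw [← zpow_add, expo, blockExpo, Matrix.of_apply, add_sub_assoc]
  rw [Finset.prod_congr rfl fun j _ => h j, Finset.prod_mul_distrib]
  congr 1
  · rw [Finset.prod_eq_single i]
    · simp
    · intro j _ hj
      simp [Ne.symm hj]
    · simp
  · rw [Fintype.prod_sigma]
    exact Finset.prod_congr rfl fun q _ =>
      Finset.prod_zpow (fun β => z ⟨q, β⟩) Finset.univ (blockExpo N i.1 q)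

theorem toNat_P_add {ν N : t.Pattern} (hP : ∀ p ∈ N.support, 0 ≤ P ν N p) (p : N.support) :
    ((P ν N p + N p).toNat : ℤ) = P ν N p + N p :=
  Int.toNat_of_nonneg (add_nonneg (hP p p.2) (Int.natCast_nonneg _))

theorem offDiagonalSolutions_eq {ν N : t.Pattern} (hP : ∀ p ∈ N.support, 0 ≤ P ν N p) :
    offDiagonalSolutions ν N =
      distinctSolutions (fun p : N.support => Fin (N p)) (fun p => (P ν N p + N p).toNat)
        (blockExpo N) fun p => (-1 : ℂˣ) ^ (PHat ν N p + N p + 1) := by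
  ext z
  refine and_congr ?_ Iff.rfl
  simp only [IsSolution, Sigma.forall, prod_zpow_expo, ← zpow_natCast, toNat_P_add hP]

/-- On the diagonal, the `-1` in `blockExpo` is multiplied by `N_p` and cancels the `N_p` in `X_p =
P_p + N_p`. -/
theorem reducedMatrix_eq {ν N : t.Pattern} (hP : ∀ p ∈ N.support, 0 ≤ P ν N p) :
    reducedMatrix (fun p : N.support => Fin (N p)) (fun p => (P ν N p + N p).toNat)
      (blockExpo N) = F ν N := by
  ext p q
  simp only [reducedMatrix, blockExpo, F, Matrix.of_apply, Fintype.card_fin, toNat_P_add hP]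
  by_cases h : p = q
  · subst h
    simp only [if_true]
    ring
  · simp [h]

end SCE

theorem theorem2 (t : SCE.AffineType) (ν N : t.Pattern)
    (hP : ∀ p ∈ N.support, 0 ≤ SCE.P ν N p) :
    (SCE.offDiagonalSolutions ν N).Finite ∧
      ((SCE.offDiagonalSolutions ν N).ncard : ℚ) / ∏ p ∈ N.support, ((N p).factorial : ℚ) =
        SCE.R ν N := by
  have hN (p : N.support) : 0 < N p := Nat.pos_of_ne_zero (Finsupp.mem_support_iff.mp p.2)
  have hX (p : N.support) : 0 < (SCE.P ν N p + N p).toNat := by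
    have := hP p p.2
    have := hN p
    omega
  have hdet := SCE.det_F_pos hP
  have hred := SCE.reducedMatrix_eq hP
  obtain ⟨hfin, hcard⟩ := natCard_distinctSolutions (K := ℂ) (J := fun p : N.support => Fin (N p))
    hX (hred ▸ hdet.ne') (fun p => (-1 : ℂˣ) ^ (SCE.PHat ν N p + N p + 1)) fun p => ⟨0, hN p⟩
  rw [← SCE.offDiagonalSolutions_eq hP] at hfin hcard
  refine ⟨Set.toFinite _, ?_⟩
  rw [hred, Nat.card_coe_set_eq] at hcard
  -- Positivity of the determinant, not only its nonvanishing, is what matches the count with the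
  -- signed determinant in `R`.
  have habs : ((SCE.F ν N).det.natAbs : ℚ) = (SCE.F ν N).det := by
    rw [Nat.cast_natAbs, abs_of_pos hdet]
  rw [hcard, SCE.R, ← Finset.prod_coe_sort N.support, Nat.cast_mul, habs, mul_div_assoc, Nat.cast_prod,
    ← Finset.prod_div_distrib]
  congr 1
  refine Finset.prod_congr rfl fun p _ => ?_
  -- As `P + N ≥ 1`, the truncated subtraction is a true one and `Ring.choose` is an ordinary
  -- binomial coefficient. The factors then agree by `(X - 1)_{N - 1} = (N - 1)! * binom(X - 1, N -
  -- 1)` and `N! = N * (N - 1)!`.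
  have hx : SCE.P ν N p + N p - 1 = (((SCE.P ν N p + N p).toNat - 1 : ℕ) : ℤ) := by
    have := hX p
    have := SCE.toNat_P_add hP p
    omega
  rw [hx, Ring.choose_natCast, Fintype.card_fin, Nat.descFactorial_eq_factorial_mul_choose,
    ← Nat.mul_factorial_pred (hN p).ne']
  have h1 : ((N p - 1).factorial : ℚ) ≠ 0 := by exact_mod_cast Nat.factorial_ne_zero _
  have h2 : (N p : ℚ) ≠ 0 := by exact_mod_cast (hN p).ne'
  push_cast
  field_simp
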